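/- Let $M$ be a compact complex manifold of complex dimension $n\ge 2$ with complex structure $I$. A Vaisman structure on $M$ is a pair $(\omega,\theta)$, where $\omega=g(I\cdot,\cdot)$ is the fundamental form of a smooth Hermitian metric $g$ on $M$ and $\theta$ (the Lee form) is a smooth closed real $1$-form such that $d\omega=\theta\wedge\omega$ and $\nabla\theta=0$ for the Levi-Civita connection $\nabla$ of $g$. Its transversal Kähler form is $\omega_0=d^c\theta$, where $d^c=I\,d\,I^{-1}$ and $I$ acts on $k$-forms by $(I\alpha)(v_1,\dots,v_k)=\alpha(I^{-1}v_1,\dots,I^{-1}v_k)$; its Lee class is the de Rham class $[\theta]\in H^1(M,\mathbb R)$. The structure is called normalized if $|\theta|_g=1$ at every point. Let $(\omega,\theta)$ and $(\omega',\theta')$ be Vaisman structures on $M$ with the same transversal Kähler form, $d^c\theta=d^c\theta'$, and the same Lee class, $[\theta]=[\theta']\in H^1(M,\mathbb R)$. Then $\theta=\theta'$. If moreover both structures are normalized, then $\omega=\omega'$ (and $g=g'$). In other words, a normalized Vaisman structure on $M$ is uniquely determined by its transversal Kähler form $\omega_0$ and its Lee class $[\theta]$. -/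

import Mathlib

open Bundle
open scoped Manifold ContDiff Topology

noncomputable section

namespace Vaisman

section Forms

variable (E : Type*) [NormedAddCommGroup E] [NormedSpace ℂ E]
variable (M : Type*) [TopologicalSpace M] [ChartedSpace E M]

/-- A complex manifold is, with the same charts, a smooth real manifold. -/
instance realManifold [IsManifold 𝓘(ℂ, E) ω M] : IsManifold 𝓘(ℝ, E) ∞ M := by
  apply isManifold_of_contDiffOn
  intro e e' he he'
  have h1 := (contDiffGroupoid ω 𝓘(ℂ, E)).compatible he he'
  have h2 := (contDiffGroupoid_le (I := 𝓘(ℂ, E)) (m := ∞) (n := ω) le_top) h1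
  exact ContDiffOn.restrict_scalars ℝ (mem_groupoid_of_pregroupoid.1 h2).1

/-- The complex structure `v ↦ i v` on the real tangent spaces. The tangent space
`TangentSpace 𝓘(ℝ, E) x` is the model space `E`, through the preferred chart at `x`; as this chart
is holomorphic, the complex structure of the manifold is multiplication by `i` in `E`. -/
def cplxJ : E →L[ℝ] E := (Complex.I • ContinuousLinearMap.id ℂ E).restrictScalars ℝ

/-- Real differential `k`-forms, not necessarily continuous: an alternating `k`-linear form on each
real tangent space `TangentSpace 𝓘(ℝ, E) x = E`. -/
abbrev DiffForm (k : ℕ) : Type _ := M → E [⋀^Fin k]→L[ℝ] ℝ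

variable {E M} {k : ℕ}

/-- The differential of the preferred chart at `p`, at the point `x`. -/
def chartD (p x : M) : E →L[ℝ] E := mfderiv 𝓘(ℝ, E) 𝓘(ℝ, E) (chartAt E p) x

/-- The differential of the inverse of the preferred chart at `p`, at the point `y`. -/
def chartSymmD (p : M) (y : E) : E →L[ℝ] E := mfderiv 𝓘(ℝ, E) 𝓘(ℝ, E) (chartAt E p).symm y

/-- The expression of a form in the preferred chart at `p`: its pullback under the inverse of that
chart (meaningful on the target of the chart). -/
def inChart (p : M) (α : DiffForm E M k) (y : E) : E [⋀^Fin k]→L[ℝ] ℝ :=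
  (α ((chartAt E p).symm y)).compContinuousLinearMap (chartSymmD p y)

/-- A form is smooth if its expressions in the charts are. -/
def IsSmooth (α : DiffForm E M k) : Prop :=
  ∀ p : M, ContDiffOn ℝ ∞ (inChart p α) (chartAt E p).target

/-- The exterior derivative, computed in the preferred chart at each point. -/
def extD (α : DiffForm E M k) : DiffForm E M (k + 1) := fun x =>
  (extDeriv (inChart x α) (chartAt E x x)).compContinuousLinearMap (chartD x x)

/-- The action of the complex structure on forms,
`(I α)(v₁, …, v_k) = α(I⁻¹ v₁, …, I⁻¹ v_k)`. -/
def actJ (α : DiffForm E M k) : DiffForm E M k := fun x =>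
  (α x).compContinuousLinearMap (-cplxJ E)

/-- The inverse action, `(I⁻¹ α)(v₁, …, v_k) = α(I v₁, …, I v_k)`. -/
def actJInv (α : DiffForm E M k) : DiffForm E M k := fun x =>
  (α x).compContinuousLinearMap (cplxJ E)

/-- The twisted differential `d^c = I d I⁻¹`. -/
def extDc (α : DiffForm E M k) : DiffForm E M (k + 1) := actJ (extD (actJInv α))

/-- The wedge product of a `1`-form and a `k`-form,
`(θ ∧ α)(v₀, …, v_k) = ∑ i, (-1)^i θ(v_i) α(v₀, …, v̂_i, …, v_k)`. -/
def wedgeOne (θ : DiffForm E M 1) (α : DiffForm E M k) : DiffForm E M (k + 1) := fun x =>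
  ContinuousAlternatingMap.alternatizeUncurryFin
    (((ContinuousAlternatingMap.ofSubsingleton ℝ E ℝ (0 : Fin 1)).symm (θ x)).smulRight (α x))

theorem inChart_add (p : M) (α β : DiffForm E M k) :
    inChart p (α + β) = inChart p α + inChart p β := by
  ext y v; simp [inChart]

theorem inChart_smul (p : M) (c : ℝ) (α : DiffForm E M k) :
    inChart p (c • α) = c • inChart p α := by
  ext y v; simp [inChart]

theorem IsSmooth.differentiableAt {α : DiffForm E M k} (h : IsSmooth α) (x : M) :
    DifferentiableAt ℝ (inChart x α) (chartAt E x x) :=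
  ((h x).contDiffAt ((chartAt E x).open_target.mem_nhds
    (mem_chart_target E x))).differentiableAt (by simp)

variable (E M)

/-- The space of smooth closed `k`-forms. -/
def closedForms (k : ℕ) : Submodule ℝ (DiffForm E M k) where
  carrier := {α | IsSmooth α ∧ extD α = 0}
  zero_mem' := by
    have h0 : ∀ p : M, inChart p (0 : DiffForm E M k) = 0 := fun p => by
      ext y v; simp [inChart]
    refine ⟨fun p => ?_, ?_⟩
    · rw [h0]; exact contDiffOn_const
    · funext x
      ext v
      simp only [extD, h0]
      have : extDeriv (0 : E → E [⋀^Fin k]→L[ℝ] ℝ) (chartAt E x x) = 0 := by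
        simpa using extDeriv_smul (x := chartAt E x x) (0 : ℝ) (0 : E → E [⋀^Fin k]→L[ℝ] ℝ)
      rw [this]
      simp
  add_mem' := by
    rintro α β ⟨ha, ha'⟩ ⟨hb, hb'⟩
    refine ⟨fun p => ?_, ?_⟩
    · rw [inChart_add]; exact (ha p).add (hb p)
    · funext x
      have h1 := congrFun ha' x
      have h2 := congrFun hb' x
      simp only [extD] at h1 h2 ⊢
      rw [inChart_add, extDeriv_add (ha.differentiableAt x) (hb.differentiableAt x)]
      ext v
      simpa using congrArg₂ (· + ·) (congrArg (· v) h1) (congrArg (· v) h2)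
  smul_mem' := by
    rintro c α ⟨ha, ha'⟩
    refine ⟨fun p => ?_, ?_⟩
    · rw [inChart_smul]; exact (ha p).const_smul c
    · funext x
      have h1 := congrFun ha' x
      simp only [extD] at h1 ⊢
      rw [inChart_smul, extDeriv_smul]
      ext v
      simpa using congrArg (fun t => c * t v) h1

/-- The space of exact `1`-forms `df`, for smooth functions `f : M → ℝ`. -/
def exactOneForms : Submodule ℝ (DiffForm E M 1) where
  carrier := {α | ∃ f : M → ℝ, ContMDiff 𝓘(ℝ, E) 𝓘(ℝ, ℝ) ∞ f ∧
    ∀ (x : M) (v : E), α x ![v] = mvfderiv 𝓘(ℝ, E) f x v}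
  zero_mem' := ⟨fun _ => 0, contMDiff_const, fun x v => by
    rw [mvfderiv_const]; rfl⟩
  add_mem' := by
    rintro α β ⟨f, hf, hf'⟩ ⟨g, hg, hg'⟩
    refine ⟨f + g, hf.add hg, fun x v => ?_⟩
    rw [mvfderiv_add ((hf x).mdifferentiableAt (by simp)) ((hg x).mdifferentiableAt (by simp))]
    exact congrArg₂ (· + ·) (hf' x v) (hg' x v)
  smul_mem' := by
    rintro c α ⟨f, hf, hf'⟩
    refine ⟨c • f, fun x =>
      (contDiff_const_smul c).contMDiff.contMDiffAt.comp x (hf x), fun x v => ?_⟩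
    rw [show mvfderiv 𝓘(ℝ, E) (c • f) x = c • mvfderiv 𝓘(ℝ, E) f x from
      const_smul_mfderiv ((hf x).mdifferentiableAt (by simp)) c]
    exact congrArg (c * ·) (hf' x v)

instance (k : ℕ) : AddCommGroup (closedForms E M k) := (closedForms E M k).addCommGroup

/-- The first de Rham cohomology `H¹(M, ℝ)`: closed `1`-forms modulo exact `1`-forms. -/
abbrev deRhamH1 : Type _ :=
  closedForms E M 1 ⧸ (exactOneForms E M).submoduleOf (closedForms E M 1)

end Forms

section Metrics

variable (E : Type*) [NormedAddCommGroup E] [NormedSpace ℂ E]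
variable (M : Type*) [TopologicalSpace M] [ChartedSpace E M] [IsManifold 𝓘(ℂ, E) ω M]

/-- Smooth Riemannian metrics on `M`. -/
abbrev Metric : Type _ :=
  ContMDiffRiemannianMetric 𝓘(ℝ, E) ∞ E (fun x : M => TangentSpace 𝓘(ℝ, E) x)

variable {E M}

/-- The metric as a bilinear form on `TangentSpace 𝓘(ℝ, E) x = E`. -/
def Metric.bil (g : Metric E M) (x : M) : E →L[ℝ] E →L[ℝ] ℝ := g.inner x

/-- `g` is Hermitian: the complex structure acts by isometries. -/
def IsHermitian (g : Metric E M) : Prop :=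
  ∀ (x : M) (u v : E), g.bil x (cplxJ E u) (cplxJ E v) = g.bil x u v

/-- The fundamental form of a Hermitian metric, `(u, v) ↦ g(I u, v)`. This bilinear form is
alternating if `g` is Hermitian; it is written here as half of its alternation,
see `fundamentalForm_apply`. -/
def fundamentalForm (g : Metric E M) : DiffForm E M 2 := fun x =>
  (1 / 2 : ℝ) • ContinuousAlternatingMap.alternatizeUncurryFin
    ((ContinuousAlternatingMap.ofSubsingletonLIE (𝕜 := ℝ) (E := E) (F := ℝ)
        (0 : Fin 1)).toContinuousLinearEquiv.toContinuousLinearMap.comp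
      ((g.bil x).comp (cplxJ E)))

theorem fundamentalForm_apply {g : Metric E M} (hg : IsHermitian g) (x : M) (u v : E) :
    fundamentalForm g x ![u, v] = g.bil x (cplxJ E u) v := by
  have h2 : cplxJ E (cplxJ E u) = -u := by
    simp [cplxJ, smul_smul]
  have h1 : g.bil x (cplxJ E v) u = -g.bil x (cplxJ E u) v := by
    have := hg x (cplxJ E u) v
    rw [h2] at this
    have hs : g.bil x (cplxJ E v) u = g.bil x u (cplxJ E v) := g.symm x _ _
    rw [hs]
    simp at this
    linarith
  simp [fundamentalForm, ContinuousAlternatingMap.alternatizeUncurryFin_apply, Fin.sum_univ_two,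
    Fin.removeNth, h1]
  ring

variable [FiniteDimensional ℂ E]

/-- The vector field `Y` is differentiable at `x`. -/
def IsDiffAt (Y : (x : M) → TangentSpace 𝓘(ℝ, E) x) (x : M) : Prop :=
  MDifferentiableAt 𝓘(ℝ, E) (𝓘(ℝ, E).prod 𝓘(ℝ, E))
    (fun y => TotalSpace.mk' E (E := fun x : M => TangentSpace 𝓘(ℝ, E) x) y (Y y)) x

/-- `D` is the Levi-Civita connection of `g`: it is torsion-free and
`v(g(Y, Z)) = g(D_v Y, Z) + g(Y, D_v Z)`. -/
structure IsLeviCivita (g : Metric E M)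
    (D : CovariantDerivative 𝓘(ℝ, E) E (fun x : M => TangentSpace 𝓘(ℝ, E) x)) : Prop where
  torsion_free : D.torsion = 0
  metric : ∀ (x : M) (Y Z : (x : M) → TangentSpace 𝓘(ℝ, E) x),
    IsDiffAt Y x → IsDiffAt Z x → ∀ v : TangentSpace 𝓘(ℝ, E) x,
      mvfderiv 𝓘(ℝ, E) (fun y => g.inner y (Y y) (Z y)) x v =
        g.inner x (D Y x v) (Z x) + g.inner x (Y x) (D Z x v)

/-- The `1`-form `θ` is parallel for the connection `D`:
`(D_v θ)(Y) = v(θ(Y)) - θ(D_v Y)` vanishes. -/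
def IsParallel (D : CovariantDerivative 𝓘(ℝ, E) E (fun x : M => TangentSpace 𝓘(ℝ, E) x))
    (θ : DiffForm E M 1) : Prop :=
  ∀ (x : M) (Y : (x : M) → TangentSpace 𝓘(ℝ, E) x), IsDiffAt Y x →
    ∀ v : TangentSpace 𝓘(ℝ, E) x,
      mvfderiv 𝓘(ℝ, E) (fun y => θ y ![Y y]) x v = θ x ![D Y x v]

variable (E M)

/-- A Vaisman structure on the complex manifold `M`: a Hermitian metric `g`, with fundamental form
`Ω = g(I·, ·)`, and a smooth closed `1`-form `θ`, the Lee form, such that `dΩ = θ ∧ Ω` and `θ` is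
parallel for the Levi-Civita connection of `g`. -/
@[ext]
structure VaismanStructure where
  g : Metric E M
  lee : DiffForm E M 1
  hermitian : IsHermitian g
  lee_mem : lee ∈ closedForms E M 1
  lck : extD (fundamentalForm g) = wedgeOne lee (fundamentalForm g)
  parallel : ∃ D : CovariantDerivative 𝓘(ℝ, E) E (fun x : M => TangentSpace 𝓘(ℝ, E) x),
    IsLeviCivita g D ∧ IsParallel D lee

variable {E M}

namespace VaismanStructure

/-- The transversal Kähler form `d^c θ`. -/
def transversalForm (S : VaismanStructure E M) : DiffForm E M 2 := extDc S.lee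

/-- The Lee class `[θ] ∈ H¹(M, ℝ)`. -/
def leeClass (S : VaismanStructure E M) : deRhamH1 E M :=
  Submodule.Quotient.mk ⟨S.lee, S.lee_mem⟩

/-- The Lee form has length one at every point: the vector `ξ` that is `g`-dual to `θ`
(the value of the Lee field) satisfies `g(ξ, ξ) = 1`. -/
def IsNormalized (S : VaismanStructure E M) : Prop :=
  ∀ x : M, ∃ ξ : E, (∀ v : E, S.lee x ![v] = S.g.bil x ξ v) ∧ S.g.bil x ξ ξ = 1

end VaismanStructure

end Metrics

end Vaisman

end

/-! Equality of Lee classes gives `θ - θ' = df`, and equality of the transversal forms gives `d d^c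
f = 0`: `f` is pluriharmonic. Its restriction to each complex line in a chart is harmonic, so the
maximum principle makes `f` constant near each local maximum. By compactness `f` is locally
constant, hence `df = 0` (`eq_zero_of_exact_of_pluriharmonic`, `VaismanStructure.lee_eq`).

For the metric, the key is the structure equation `d(θ ∘ I) = |θ|² Ω + θ ∧ (θ ∘ I)`
(`fderiv_inChart_lee_cplxJ`). Once `|θ| = 1`, it expresses `Ω`, and hence `g`, through `θ` alone
(`VaismanStructure.eq_of_lee_eq`). It is obtained pointwise: a parallel `θ = g(T, ·)` has
derivatives given by Koszul's formula in the first derivatives of `g`, and the combination needed is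
the sum of `dΩ = θ ∧ Ω` at `(u, v, T)` and at `(Iu, Iv, T)`. -/

noncomputable section

namespace Vaisman

/-! ### Charts, transition maps and the chart independence of `d` -/

section Charts

variable {E : Type*} [NormedAddCommGroup E] [NormedSpace ℂ E]
variable {M : Type*} [TopologicalSpace M] [ChartedSpace E M]

/-- The transition map from the preferred chart at `p` to the preferred chart at `q`. -/
def transition (p q : M) : E → E := chartAt E q ∘ (chartAt E p).symm

variable [IsManifold 𝓘(ℂ, E) ω M] {k : ℕ}

/-- The tangent space at `x` is identified with `E` by the preferred chart at `x` itself. Hence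
tensor identities at the centre of a chart need no change of frame. -/
theorem chartD_self (x : M) : chartD x x = ContinuousLinearMap.id ℝ E := by
  ext v
  have h := mfderiv_chartAt_eq_tangentCoordChange (I := 𝓘(ℝ, E)) (mem_chart_source E x)
  have h2 := tangentCoordChange_self (I := 𝓘(ℝ, E)) (x := x) (z := x) (v := v)
    (by simp)
  unfold chartD
  rw [h]
  exact h2

theorem extD_eq (α : DiffForm E M k) (x : M) :
    extD α x = extDeriv (inChart x α) (chartAt E x x) := by
  ext v
  simp [extD, chartD_self]

theorem contDiffAt_transition {p q : M} {y : E} (hy : y ∈ (chartAt E p).target)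
    (hq : (chartAt E p).symm y ∈ (chartAt E q).source) :
    ContDiffAt ℂ ω (transition p q) y := by
  have h1 := (contDiffGroupoid ω 𝓘(ℂ, E)).compatible (chart_mem_atlas E p) (chart_mem_atlas E q)
  have h3 : ContDiffOn ℂ ω (transition p q)
      ((chartAt E p).symm ≫ₕ chartAt E q).source := by
    simpa [contDiffPregroupoid, transition] using (mem_groupoid_of_pregroupoid.1 h1).1
  refine h3.contDiffAt (((chartAt E p).symm ≫ₕ chartAt E q).open_source.mem_nhds ?_)
  simp [hy, hq]

theorem chartSymm_mdifferentiableAt {p : M} {y : E} (hy : y ∈ (chartAt E p).target) :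
    MDifferentiableAt 𝓘(ℝ, E) 𝓘(ℝ, E) (chartAt E p).symm y :=
  mdifferentiableAt_atlas_symm (chart_mem_atlas E p) hy

theorem chart_mdifferentiableAt {p x : M} (hx : x ∈ (chartAt E p).source) :
    MDifferentiableAt 𝓘(ℝ, E) 𝓘(ℝ, E) (chartAt E p) x :=
  mdifferentiableAt_atlas (chart_mem_atlas E p) hx

/-- The frame of the tangent space varies with the point: at `(chartAt E p).symm y` it comes from
the preferred chart at that point, so the differential is that of the transition into this chart. -/
theorem chartSymmD_eq_fderiv {p : M} {y : E} (hy : y ∈ (chartAt E p).target) :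
    chartSymmD p y = fderiv ℝ (transition p ((chartAt E p).symm y)) y := by
  refine (chartSymm_mdifferentiableAt hy).mfderiv.trans ?_
  simp [writtenInExtChartAt, transition, extChartAt]
  rfl

theorem contDiffAt_transition_real {p q : M} {y : E} (hy : y ∈ (chartAt E p).target)
    (hq : (chartAt E p).symm y ∈ (chartAt E q).source) :
    ContDiffAt ℝ ω (transition p q) y :=
  (contDiffAt_transition hy hq).restrict_scalars ℝ

/-- Transition maps are holomorphic, so their real differentials are complex linear. -/
theorem chartSymmD_cplxJ {p : M} {y : E} (hy : y ∈ (chartAt E p).target) (v : E) :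
    chartSymmD p y (cplxJ E v) = cplxJ E (chartSymmD p y v) := by
  have h := (contDiffAt_transition (q := (chartAt E p).symm y) hy
    (mem_chart_source E _)).differentiableAt (by simp)
  rw [chartSymmD_eq_fderiv hy, h.fderiv_restrictScalars ℝ]
  simp [cplxJ]

theorem chartSymmD_transition {p q : M} {y : E} (hy : y ∈ (chartAt E p).target)
    (hq : (chartAt E p).symm y ∈ (chartAt E q).source) :
    chartSymmD p y =
      (chartSymmD q (transition p q y)).comp (fderiv ℝ (transition p q) y) := by
  have hty : transition p q y ∈ (chartAt E q).target := (chartAt E q).map_source hq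
  have hd : DifferentiableAt ℝ (transition p q) y :=
    (contDiffAt_transition_real hy hq).differentiableAt (by simp)
  have h := mfderiv_comp (I := 𝓘(ℝ, E)) (I' := 𝓘(ℝ, E)) (I'' := 𝓘(ℝ, E)) y
    (g := (chartAt E q).symm) (f := transition p q) (chartSymm_mdifferentiableAt hty)
    hd.mdifferentiableAt
  have he : (chartAt E q).symm ∘ transition p q =ᶠ[𝓝 y] (chartAt E p).symm := by
    have : ∀ᶠ z in 𝓝 y, (chartAt E p).symm z ∈ (chartAt E q).source :=
      ((chartAt E p).continuousAt_symm hy).eventually_mem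
        ((chartAt E q).open_source.mem_nhds hq)
    filter_upwards [this] with z hz
    simp [transition, hz]
  rw [he.mfderiv_eq, mfderiv_eq_fderiv] at h
  exact h

theorem inChart_transition (α : DiffForm E M k) {p q : M} {y : E} (hy : y ∈ (chartAt E p).target)
    (hq : (chartAt E p).symm y ∈ (chartAt E q).source) :
    inChart p α y =
      (inChart q α (transition p q y)).compContinuousLinearMap (fderiv ℝ (transition p q) y) := by
  have h1 : (chartAt E q).symm (transition p q y) = (chartAt E p).symm y := by
    simp [transition, hq]
  ext v
  simp only [inChart, ContinuousAlternatingMap.compContinuousLinearMap_apply, h1,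
    chartSymmD_transition hy hq]
  rfl

/-- In the preferred chart at `p`, the exterior derivative is that of the expression of the form
in this chart. -/
theorem extDeriv_inChart {α : DiffForm E M k} {p : M} {y : E} (hy : y ∈ (chartAt E p).target)
    (hα : DifferentiableAt ℝ (inChart ((chartAt E p).symm y) α)
      (chartAt E ((chartAt E p).symm y) ((chartAt E p).symm y))) :
    extDeriv (inChart p α) y =
      (extD α ((chartAt E p).symm y)).compContinuousLinearMap (chartSymmD p y) := by
  set x := (chartAt E p).symm y with hx
  have hq : x ∈ (chartAt E x).source := mem_chart_source E x
  -- Near `y` the expression in the chart at `p` is the pullback, under the transition map, of the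
  -- expression in the chart at `x`; the exterior derivative commutes with this pullback.
  have he : inChart p α =ᶠ[𝓝 y] fun z => (inChart x α (transition p x z)).compContinuousLinearMap
      (fderiv ℝ (transition p x) z) := by
    have : ∀ᶠ z in 𝓝 y, (chartAt E p).symm z ∈ (chartAt E x).source :=
      ((chartAt E p).continuousAt_symm hy).eventually_mem
        ((chartAt E x).open_source.mem_nhds hq)
    filter_upwards [this, (chartAt E p).open_target.mem_nhds hy] with z hz hz'
    exact inChart_transition α hz' hz
  rw [he.extDeriv_eq, extDeriv_pullback (r := ω) (by exact hα)
    (contDiffAt_transition_real hy hq) (by simp), extD_eq, chartSymmD_eq_fderiv hy]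
  rfl

end Charts

/-! ### The maximum principle for harmonic and pluriharmonic functions -/

section MaximumPrinciple

open _root_.Metric InnerProductSpace

/-- On a disc `h` is the real part of a holomorphic `F`, and `|exp F| = exp h` is subject to the
maximum modulus principle. -/
theorem eqOn_ball_of_harmonicOnNhd_of_isMaxOn {h : ℂ → ℝ} {c : ℂ} {R : ℝ}
    (hh : HarmonicOnNhd h (ball c R)) (hmax : IsMaxOn h (ball c R) c) :
    ∀ z ∈ ball c R, h z = h c := by
  intro z hz
  have hc : c ∈ ball c R := mem_ball_self (pos_of_mem_ball hz)
  obtain ⟨F, hF, hFh⟩ := hh.exists_analyticOnNhd_ball_re_eq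
  have hd : DifferentiableOn ℂ (fun z => Complex.exp (F z)) (ball c R) :=
    hF.differentiableOn.cexp
  have hnorm : ∀ w ∈ ball c R, ‖Complex.exp (F w)‖ = Real.exp (h w) := fun w hw => by
    rw [Complex.norm_exp, ← hFh hw]
  have hm : IsMaxOn (norm ∘ fun z => Complex.exp (F z)) (ball c R) c := fun w hw => by
    simp only [Set.mem_ofPred_eq, Function.comp_apply, hnorm w hw, hnorm c hc]
    exact Real.exp_le_exp.2 (hmax hw)
  have h1 := Complex.eqOn_of_isPreconnected_of_isMaxOn_norm
    (convex_ball c R).isPreconnected isOpen_ball hd hc hm hz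
  have h2 := congrArg norm h1
  simp only [Function.const_apply, hnorm z hz, hnorm c hc] at h2
  exact Real.exp_injective h2

variable {E : Type*} [NormedAddCommGroup E] [NormedSpace ℂ E]

/-- The maximum principle for pluriharmonic functions on a ball. -/
theorem eqOn_ball_of_pluriharmonic_of_isMaxOn {F : E → ℝ} {c : E} {R : ℝ}
    (hF : ContDiffOn ℝ 2 F (ball c R))
    (hlap : ∀ y ∈ ball c R, ∀ u : E, fderiv ℝ (fderiv ℝ F) y u u +
      fderiv ℝ (fderiv ℝ F) y (cplxJ E u) (cplxJ E u) = 0)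
    (hmax : IsMaxOn F (ball c R) c) : ∀ y ∈ ball c R, F y = F c := by
  intro y hy
  rcases eq_or_ne y c with rfl | hyc
  · rfl
  set v := y - c with hv
  have hv0 : 0 < ‖v‖ := norm_pos_iff.2 (sub_ne_zero.2 hyc)
  have hvR : ‖v‖ < R := by simpa [dist_eq_norm] using hy
  -- Restriction to the complex line through `c` and `y`: the disc of radius `R / ‖v‖ > 1` maps into
  -- the ball, with `0 ↦ c` and `1 ↦ y`.
  let ℓ : ℂ →L[ℝ] E := ((ContinuousLinearMap.id ℂ ℂ).smulRight v).restrictScalars ℝ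
  have hℓ : ∀ z, ℓ z = z • v := fun z => by simp [ℓ]
  let h : ℂ → ℝ := fun z => F (c + ℓ z)
  have hmem : ∀ z ∈ ball (0 : ℂ) (R / ‖v‖), c + ℓ z ∈ ball c R := fun z hz => by
    rw [mem_ball_zero_iff, lt_div_iff₀ hv0] at hz
    simpa [hℓ, norm_smul] using hz
  have hFat : ∀ w ∈ ball c R, ContDiffAt ℝ 2 F w := fun w hw =>
    hF.contDiffAt (isOpen_ball.mem_nhds hw)
  have hat : ∀ z ∈ ball (0 : ℂ) (R / ‖v‖), ContDiffAt ℝ 2 h z := fun z hz =>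
    (hFat _ (hmem z hz)).comp z (by fun_prop)
  have hd1 : ∀ z : ℂ, HasFDerivAt (fun z => c + ℓ z) ℓ z := fun z =>
    ℓ.hasFDerivAt.const_add c
  have h1 : ∀ z ∈ ball (0 : ℂ) (R / ‖v‖), fderiv ℝ h z = (fderiv ℝ F (c + ℓ z)).comp ℓ :=
    fun z hz => (((hFat _ (hmem z hz)).differentiableAt (by simp)).hasFDerivAt.comp z
      (hd1 z)).fderiv
  have h2 : ∀ z ∈ ball (0 : ℂ) (R / ‖v‖), ∀ a : ℂ, fderiv ℝ (fderiv ℝ h) z a a =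
      fderiv ℝ (fderiv ℝ F) (c + ℓ z) (a • v) (a • v) := by
    intro z hz a
    have he : fderiv ℝ h =ᶠ[𝓝 z] fun z => (fderiv ℝ F (c + ℓ z)).comp ℓ :=
      Filter.eventually_of_mem (isOpen_ball.mem_nhds hz) h1
    have hF2 : HasFDerivAt (fderiv ℝ F) (fderiv ℝ (fderiv ℝ F) (c + ℓ z)) (c + ℓ z) :=
      (((hFat _ (hmem z hz)).fderiv_right (m := 1) (by norm_num)).differentiableAt
        (by simp)).hasFDerivAt
    have h3 := (hF2.comp z (hd1 z)).clm_comp (hasFDerivAt_const ℓ z)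
    rw [he.fderiv_eq]
    erw [h3.fderiv]
    simp [hℓ]
  have hharm : HarmonicOnNhd h (ball (0 : ℂ) (R / ‖v‖)) := by
    intro z hz
    refine ⟨hat z hz, Filter.eventually_of_mem (isOpen_ball.mem_nhds hz) fun w hw => ?_⟩
    rw [laplacian_eq_iteratedFDeriv_complexPlane]
    -- The Laplacian on `ℂ` sums the second derivatives along `1` and `i`, which `ℓ` sends to `v`
    -- and `I v`.
    have := hlap _ (hmem w hw) v
    simpa [iteratedFDeriv_two_apply, h2 w hw, cplxJ] using this
  have hmax' : IsMaxOn h (ball (0 : ℂ) (R / ‖v‖)) 0 := fun z hz => by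
    have := hmax (hmem z hz)
    simpa [h] using this
  have := eqOn_ball_of_harmonicOnNhd_of_isMaxOn hharm hmax' 1
    (by rw [mem_ball_zero_iff, lt_div_iff₀ hv0]; simpa using hvR)
  simpa [h, hℓ, hv] using this

end MaximumPrinciple

/-! ### The operator `d^c` in charts, and `d d^c f = 0` on a compact manifold -/

section TwistedDifferential

variable {E : Type*} [NormedAddCommGroup E] [NormedSpace ℂ E]

theorem cplxJ_cplxJ (u : E) : cplxJ E (cplxJ E u) = -u := by
  simp [cplxJ, smul_smul]

theorem extDeriv_one_form_apply (A : E → E [⋀^Fin 1]→L[ℝ] ℝ) (y u v : E) :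
    extDeriv A y ![u, v] = fderiv ℝ A y u ![v] - fderiv ℝ A y v ![u] := by
  have h0 : (0 : Fin 2).removeNth ![u, v] = ![v] := by ext i; fin_cases i; rfl
  have h1 : (1 : Fin 2).removeNth ![u, v] = ![u] := by ext i; fin_cases i; rfl
  simp [extDeriv, ContinuousAlternatingMap.alternatizeUncurryFin_apply, Fin.sum_univ_two, h0, h1,
    sub_eq_add_neg]

theorem extDeriv_two_form_apply (A : E → E [⋀^Fin 2]→L[ℝ] ℝ) (y u v w : E) :
    extDeriv A y ![u, v, w] =
      fderiv ℝ A y u ![v, w] - fderiv ℝ A y v ![u, w] + fderiv ℝ A y w ![u, v] := by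
  have h0 : (0 : Fin 3).removeNth ![u, v, w] = ![v, w] := by ext i; fin_cases i <;> rfl
  have h1 : (1 : Fin 3).removeNth ![u, v, w] = ![u, w] := by ext i; fin_cases i <;> rfl
  have h2 : (2 : Fin 3).removeNth ![u, v, w] = ![u, v] := by ext i; fin_cases i <;> rfl
  simp [extDeriv, ContinuousAlternatingMap.alternatizeUncurryFin_apply, Fin.sum_univ_three,
    h0, h1, h2, sub_eq_add_neg]

variable {M : Type*} {k : ℕ}

theorem wedgeOne_apply (θ : DiffForm E M 1) (Ω : DiffForm E M 2) (x : M) (u v w : E) :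
    wedgeOne θ Ω x ![u, v, w] =
      θ x ![u] * Ω x ![v, w] - θ x ![v] * Ω x ![u, w] + θ x ![w] * Ω x ![u, v] := by
  have h0 : (0 : Fin 3).removeNth ![u, v, w] = ![v, w] := by ext i; fin_cases i <;> rfl
  have h1 : (1 : Fin 3).removeNth ![u, v, w] = ![u, w] := by ext i; fin_cases i <;> rfl
  have h2 : (2 : Fin 3).removeNth ![u, v, w] = ![u, v] := by ext i; fin_cases i <;> rfl
  have h3 : ∀ z : E, (fun _ : Fin 1 => z) = ![z] := fun z => by funext i; fin_cases i; rfl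
  simp [wedgeOne, ContinuousAlternatingMap.alternatizeUncurryFin_apply, Fin.sum_univ_three,
    h0, h1, h2, h3, sub_eq_add_neg]

/-- The action is inverted by evaluating on the vectors `I vᵢ`, because `-I I = 1`. This cancels the
outer `I` in `d^c = I d I⁻¹`. -/
theorem actJ_injective : Function.Injective (actJ : DiffForm E M k → DiffForm E M k) := by
  intro α β h
  funext x
  ext v
  have h1 := congrArg (fun γ : DiffForm E M k => γ x (fun i => cplxJ E (v i))) h
  have h2 : (fun i => -cplxJ E (cplxJ E (v i))) = v := by simp [cplxJ_cplxJ]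
  simpa [actJ, Function.comp_def, h2] using h1

variable [TopologicalSpace M] [ChartedSpace E M]

theorem inChart_sub (p : M) (α β : DiffForm E M k) :
    inChart p (α - β) = inChart p α - inChart p β := by
  ext y v; simp [inChart]

theorem IsSmooth.contDiffAt {α : DiffForm E M k} (h : IsSmooth α) {p : M} {y : E}
    (hy : y ∈ (chartAt E p).target) : ContDiffAt ℝ ∞ (inChart p α) y :=
  (h p).contDiffAt ((chartAt E p).open_target.mem_nhds hy)

variable [IsManifold 𝓘(ℂ, E) ω M]

/-- In a holomorphic chart `I` has constant coefficients, so its action on forms is a fixed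
continuous linear map and commutes with differentiation. -/
theorem inChart_actJInv (α : DiffForm E M k) {p : M} {y : E} (hy : y ∈ (chartAt E p).target) :
    inChart p (actJInv α) y =
      ContinuousAlternatingMap.compContinuousLinearMapCLM (cplxJ E) (inChart p α y) := by
  ext v
  simp only [inChart, actJInv, ContinuousAlternatingMap.compContinuousLinearMapCLM_apply,
    ContinuousAlternatingMap.compContinuousLinearMap_apply]
  congr 1
  funext i
  exact (chartSymmD_cplxJ hy (v i)).symm

theorem hasFDerivAt_inChart_actJInv {α : DiffForm E M k} (h : IsSmooth α) {p : M} {y : E}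
    (hy : y ∈ (chartAt E p).target) :
    HasFDerivAt (inChart p (actJInv α))
      ((ContinuousAlternatingMap.compContinuousLinearMapCLM (cplxJ E)).comp
        (fderiv ℝ (inChart p α) y)) y := by
  have he : inChart p (actJInv α) =ᶠ[𝓝 y] fun z =>
      ContinuousAlternatingMap.compContinuousLinearMapCLM (cplxJ E) (inChart p α z) :=
    Filter.eventually_of_mem ((chartAt E p).open_target.mem_nhds hy)
      fun z hz => inChart_actJInv α hz
  exact ((ContinuousLinearMap.hasFDerivAt _).comp y
    ((h.contDiffAt hy).differentiableAt (by simp)).hasFDerivAt).congr_of_eventuallyEq he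

theorem extDeriv_inChart_actJInv {θ : DiffForm E M 1} (h : IsSmooth θ) {p : M} {y : E}
    (hy : y ∈ (chartAt E p).target) (u v : E) :
    extDeriv (inChart p (actJInv θ)) y ![u, v] =
      fderiv ℝ (inChart p θ) y u ![cplxJ E v] - fderiv ℝ (inChart p θ) y v ![cplxJ E u] := by
  have h1 : ∀ w : E, cplxJ E ∘ ![w] = ![cplxJ E w] := fun w => by
    funext i; fin_cases i; rfl
  simp [extDeriv_one_form_apply, (hasFDerivAt_inChart_actJInv h hy).fderiv, h1]

/-- If `d^c θ = d^c θ'`, then the derivatives of `θ` and `θ'` in a chart have the same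
alternation twisted by the complex structure. -/
theorem fderiv_inChart_of_extDc_eq {θ θ' : DiffForm E M 1} (h : IsSmooth θ) (h' : IsSmooth θ')
    (hdc : extDc θ = extDc θ') {p : M} {y : E} (hy : y ∈ (chartAt E p).target) (u v : E) :
    fderiv ℝ (inChart p (θ - θ')) y u ![cplxJ E v] =
      fderiv ℝ (inChart p (θ - θ')) y v ![cplxJ E u] := by
  have hd : extD (actJInv θ) = extD (actJInv θ') := actJ_injective hdc
  have hdiff : ∀ {α : DiffForm E M 1}, IsSmooth α → ∀ x : M,
      DifferentiableAt ℝ (inChart x (actJInv α)) (chartAt E x x) := fun hα x =>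
    (hasFDerivAt_inChart_actJInv hα (mem_chart_target E x)).differentiableAt
  have key : extDeriv (inChart p (actJInv θ)) y = extDeriv (inChart p (actJInv θ')) y := by
    rw [extDeriv_inChart hy (hdiff h _), extDeriv_inChart hy (hdiff h' _), hd]
  have h2 := congrArg (fun A => A ![u, v]) key
  simp only [extDeriv_inChart_actJInv h hy, extDeriv_inChart_actJInv h' hy] at h2
  rw [inChart_sub, fderiv_sub ((h.contDiffAt hy).differentiableAt (by simp))
    ((h'.contDiffAt hy).differentiableAt (by simp))]
  simp only [sub_apply, ContinuousAlternatingMap.sub_apply]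
  linarith

theorem contDiffAt_comp_chart_symm {f : M → ℝ} (hf : ContMDiff 𝓘(ℝ, E) 𝓘(ℝ, ℝ) ∞ f) {p : M}
    {y : E} (hy : y ∈ (chartAt E p).target) :
    ContDiffAt ℝ ∞ (f ∘ (chartAt E p).symm) y := by
  have h1 : ContMDiffAt 𝓘(ℝ, E) 𝓘(ℝ, E) ∞ (chartAt E p).symm y :=
    (contMDiffOn_chart_symm (I := 𝓘(ℝ, E)) (n := ∞) (x := p)).contMDiffAt
      ((chartAt E p).open_target.mem_nhds hy)
  exact ((hf _).comp y h1).contDiffAt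

theorem inChart_apply_of_exact {α : DiffForm E M 1} {f : M → ℝ}
    (hf : ContMDiff 𝓘(ℝ, E) 𝓘(ℝ, ℝ) ∞ f)
    (hα : ∀ (x : M) (v : E), α x ![v] = mvfderiv 𝓘(ℝ, E) f x v) {p : M} {y : E}
    (hy : y ∈ (chartAt E p).target) (v : E) :
    inChart p α y ![v] = fderiv ℝ (f ∘ (chartAt E p).symm) y v := by
  have h1 : chartSymmD p y ∘ ![v] = ![chartSymmD p y v] := by funext i; fin_cases i; rfl
  have h2 := mfderiv_comp (I := 𝓘(ℝ, E)) (I' := 𝓘(ℝ, E)) (I'' := 𝓘(ℝ, ℝ)) y (g := f)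
    (f := (chartAt E p).symm) ((hf _).mdifferentiableAt (by simp)) (chartSymm_mdifferentiableAt hy)
  rw [mfderiv_eq_fderiv] at h2
  rw [h2]
  simp only [inChart, ContinuousAlternatingMap.compContinuousLinearMap_apply, h1, hα]
  rfl

theorem fderiv_inChart_of_exact {α : DiffForm E M 1} {f : M → ℝ}
    (hf : ContMDiff 𝓘(ℝ, E) 𝓘(ℝ, ℝ) ∞ f)
    (hα : ∀ (x : M) (v : E), α x ![v] = mvfderiv 𝓘(ℝ, E) f x v) {p : M} {y : E}
    (hy : y ∈ (chartAt E p).target) (u v : E) :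
    fderiv ℝ (inChart p α) y u ![v] =
      fderiv ℝ (fderiv ℝ (f ∘ (chartAt E p).symm)) y u v := by
  let L : (E →L[ℝ] ℝ) →L[ℝ] E [⋀^Fin 1]→L[ℝ] ℝ :=
    (ContinuousAlternatingMap.ofSubsingletonLIE (𝕜 := ℝ) (E := E) (F := ℝ)
        (0 : Fin 1)).toContinuousLinearEquiv.toContinuousLinearMap
  have he : inChart p α =ᶠ[𝓝 y] fun z => L (fderiv ℝ (f ∘ (chartAt E p).symm) z) := by
    filter_upwards [(chartAt E p).open_target.mem_nhds hy] with z hz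
    ext w
    have hw : w = ![w 0] := by funext i; fin_cases i; rfl
    rw [hw, inChart_apply_of_exact hf hα hz]
    simp [L]
  have hd : DifferentiableAt ℝ (fderiv ℝ (f ∘ (chartAt E p).symm)) y :=
    ((contDiffAt_comp_chart_symm hf hy).fderiv_right (m := 1) (by norm_cast)).differentiableAt
      (by simp)
  have h3 := (L.hasFDerivAt.comp y hd.hasFDerivAt).fderiv
  rw [he.fderiv_eq]
  erw [h3]
  simp [L]

/-- On a compact complex manifold, a smooth function `f` with `d d^c f = 0` has `d f = 0`. -/
theorem eq_zero_of_exact_of_pluriharmonic [CompactSpace M] {α : DiffForm E M 1} {f : M → ℝ}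
    (hf : ContMDiff 𝓘(ℝ, E) 𝓘(ℝ, ℝ) ∞ f)
    (hα : ∀ (x : M) (v : E), α x ![v] = mvfderiv 𝓘(ℝ, E) f x v)
    (hJ : ∀ p : M, ∀ y ∈ (chartAt E p).target, ∀ u v : E,
      fderiv ℝ (inChart p α) y u ![cplxJ E v] = fderiv ℝ (inChart p α) y v ![cplxJ E u]) :
    α = 0 := by
  have : LocallyConnectedSpace M := ChartedSpace.locallyConnectedSpace E M
  have hfc : Continuous f := hf.continuous
  have hlocal : ∀ p : M, IsLocalMax f p → ∀ᶠ x in 𝓝 p, f x = f p := by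
    intro p hp
    have hpt := mem_chart_target E p
    have hp' : ∀ᶠ y in 𝓝 (chartAt E p p), f ((chartAt E p).symm y) ≤ f p := by
      have hc := (chartAt E p).continuousAt_symm hpt
      rw [ContinuousAt, (chartAt E p).left_inv (mem_chart_source E p)] at hc
      exact hc.eventually hp
    obtain ⟨R, hR, hball⟩ := _root_.Metric.eventually_nhds_iff_ball.1
      (hp'.and ((chartAt E p).open_target.mem_nhds hpt))
    have hconst := eqOn_ball_of_pluriharmonic_of_isMaxOn
      (F := f ∘ (chartAt E p).symm) (c := chartAt E p p) (R := R)
      (fun y hy => ((contDiffAt_comp_chart_symm hf (hball y hy).2).of_le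
        (by norm_cast)).contDiffWithinAt) (fun y hy u => by
        have hy' := (hball y hy).2
        -- Taking `v = I u` turns the symmetry `hJ` into the vanishing of the Laplacian along the
        -- complex line spanned by `u`.
        have := hJ p y hy' u (cplxJ E u)
        rw [cplxJ_cplxJ, fderiv_inChart_of_exact hf hα hy', fderiv_inChart_of_exact hf hα hy']
          at this
        rw [map_neg] at this
        linarith) (fun y hy => by
        simpa [(chartAt E p).left_inv (mem_chart_source E p)] using (hball y hy).1)
    have hc := (chartAt E p).continuousAt (mem_chart_source E p)
    filter_upwards [hc.eventually_mem (_root_.Metric.ball_mem_nhds _ hR),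
      (chartAt E p).open_source.mem_nhds (mem_chart_source E p)] with x hx hxs
    have := hconst _ hx
    simpa [(chartAt E p).left_inv (mem_chart_source E p), (chartAt E p).left_inv hxs] using this
  have hconst : ∀ x : M, ∀ᶠ y in 𝓝 x, f y = f x := by
    intro x
    have hC : IsCompact (connectedComponent x) := isClosed_connectedComponent.isCompact
    have hCo : IsOpen (connectedComponent x) := isOpen_connectedComponent
    obtain ⟨p, hpC, hpmax⟩ := hC.exists_isMaxOn ⟨x, mem_connectedComponent⟩ hfc.continuousOn
    -- `M` may be disconnected, so the maximum is taken on each component, which is open by local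
    -- connectedness. The set where it is attained is clopen, hence the whole component.
    have hopen : IsOpen {y | y ∈ connectedComponent x ∧ f y = f p} := by
      rw [isOpen_iff_mem_nhds]
      rintro y ⟨hy, hyp⟩
      have hmax : IsLocalMax f y := by
        filter_upwards [hCo.mem_nhds hy] with z hz
        rw [hyp]
        exact hpmax hz
      filter_upwards [hlocal y hmax, hCo.mem_nhds hy] with z hz hz'
      exact ⟨hz', hz.trans hyp⟩
    have hclosed : IsClosed {y | y ∈ connectedComponent x ∧ f y = f p} :=
      isClosed_connectedComponent.inter (isClosed_eq hfc continuous_const)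
    have hsub : connectedComponent x ⊆ {y | y ∈ connectedComponent x ∧ f y = f p} :=
      isPreconnected_connectedComponent.subset_isClopen ⟨hclosed, hopen⟩ ⟨p, hpC, hpC, rfl⟩
    filter_upwards [hCo.mem_nhds mem_connectedComponent] with y hy
    rw [(hsub hy).2, (hsub mem_connectedComponent).2]
  funext x
  ext w
  have hw : w = ![w 0] := by funext i; fin_cases i; rfl
  have hz : mfderiv 𝓘(ℝ, E) 𝓘(ℝ, ℝ) f x = mfderiv 𝓘(ℝ, E) 𝓘(ℝ, ℝ) (fun _ : M => f x) x :=
    Filter.EventuallyEq.mfderiv_eq (hconst x)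
  have h0 : mvfderiv 𝓘(ℝ, E) f x = 0 := by
    rw [mfderiv_const] at hz
    ext v
    exact congrArg (fun A => A v) hz
  rw [hw, hα, h0]
  rfl

end TwistedDifferential

/-! ### Coordinate vector fields -/

section CoordinateFields

variable {E : Type*} [NormedAddCommGroup E] [NormedSpace ℂ E]
variable {M : Type*} [TopologicalSpace M] [ChartedSpace E M]

/-- The coordinate vector field with constant coefficients `u` in the preferred chart at `p`. -/
def coordField (p : M) (u : E) : (x : M) → TangentSpace 𝓘(ℝ, E) x :=
  VectorField.mpullback 𝓘(ℝ, E) 𝓘(ℝ, E) (chartAt E p) (fun _ => u)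

variable [IsManifold 𝓘(ℂ, E) ω M]

theorem chartD_comp_chartSymmD {p x : M} (hx : x ∈ (chartAt E p).source) :
    (chartD p x).comp (chartSymmD p (chartAt E p x)) = ContinuousLinearMap.id ℝ E := by
  have := mfderiv_extChartAt_comp_mfderivWithin_extChartAt_symm' (I := 𝓘(ℝ, E)) (x := p) (y := x)
    (by simpa using hx)
  simp [extChartAt] at this
  exact this

theorem chartSymmD_comp_chartD {p x : M} (hx : x ∈ (chartAt E p).source) :
    (chartSymmD p (chartAt E p x)).comp (chartD p x) = ContinuousLinearMap.id ℝ E := by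
  have := mfderivWithin_extChartAt_symm_comp_mfderiv_extChartAt' (I := 𝓘(ℝ, E)) (x := p) (y := x)
    (by simpa using hx)
  simp [extChartAt] at this
  exact this

theorem coordField_apply {p x : M} (hx : x ∈ (chartAt E p).source) (u : E) :
    coordField p u x = chartSymmD p (chartAt E p x) u := by
  have h : (chartD p x).inverse = chartSymmD p (chartAt E p x) :=
    ContinuousLinearMap.inverse_eq (chartD_comp_chartSymmD hx) (chartSymmD_comp_chartD hx)
  exact congrArg (fun A : E →L[ℝ] E => A u) h

theorem coordField_self (p : M) (u : E) : coordField p u p = u := by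
  have h : (chartD p p).inverse = ContinuousLinearMap.id ℝ E := by
    rw [chartD_self, ContinuousLinearMap.inverse_id]
  exact congrArg (fun A : E →L[ℝ] E => A u) h

theorem contMDiffAt_coordField [CompleteSpace E] {p x : M} (hx : x ∈ (chartAt E p).source)
    (u : E) : ContMDiffAt 𝓘(ℝ, E) (𝓘(ℝ, E).prod 𝓘(ℝ, E)) ∞
      (fun y => TotalSpace.mk' E (E := fun x : M => TangentSpace 𝓘(ℝ, E) x) y
        (coordField p u y)) x := by
  refine ContMDiffAt.mpullback_vectorField_preimage (n := ∞) (m := ∞) ?_ ?_ ?_ ?_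
  · exact contMDiffAt_vectorSpace_iff_contDiffAt.2 contDiffAt_const
  · exact (contMDiffOn_chart (I := 𝓘(ℝ, E)) (n := ∞) (x := p)).contMDiffAt
      ((chartAt E p).open_source.mem_nhds hx)
  · have h : (chartD p x).IsInvertible := ContinuousLinearMap.IsInvertible.of_inverse
      (chartD_comp_chartSymmD hx) (chartSymmD_comp_chartD hx)
    exact h
  · simp

/-- Constant fields on `E` commute and pullback respects brackets. With zero torsion this yields the
symmetry of the Christoffel symbols. -/
theorem mlieBracket_coordField [CompleteSpace E] (p : M) (u v : E) :
    VectorField.mlieBracket 𝓘(ℝ, E) (coordField p u) (coordField p v) p = 0 := by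
  have hc : ∀ w : E, MDifferentiableAt 𝓘(ℝ, E) (𝓘(ℝ, E).prod 𝓘(ℝ, E))
      (fun y => TotalSpace.mk' E (E := fun x : E => TangentSpace 𝓘(ℝ, E) x) y w)
      (chartAt E p p) := fun w => by
    refine ContMDiffAt.mdifferentiableAt (n := ∞) ?_ (by simp)
    exact contMDiffAt_vectorSpace_iff_contDiffAt.2 contDiffAt_const
  have : IsManifold 𝓘(ℝ, E) (minSmoothness ℝ 2) M := by
    rw [minSmoothness_of_isRCLikeNormedField]; infer_instance
  have h := VectorField.mpullback_mlieBracket (I := 𝓘(ℝ, E)) (I' := 𝓘(ℝ, E)) (n := ∞)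
    (f := chartAt E p) (x₀ := p) (hc u) (hc v)
    ((contMDiffOn_chart (I := 𝓘(ℝ, E)) (n := ∞) (x := p)).contMDiffAt
      ((chartAt E p).open_source.mem_nhds (mem_chart_source E p)))
    (by rw [minSmoothness_of_isRCLikeNormedField]; norm_cast)
  have h0 : VectorField.mlieBracket 𝓘(ℝ, E) (fun _ : E => u) (fun _ : E => v) = 0 := by
    refine (VectorField.mlieBracketWithin_eq_lieBracketWithin (s := Set.univ)).trans ?_
    funext y
    simp [VectorField.lieBracketWithin]
    rfl
  rw [h0, VectorField.mpullback_zero] at h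
  exact h.symm

theorem mvfderiv_eq_of_eventuallyEq_comp_chart {φ : M → ℝ} {Φ : E → ℝ} {p : M}
    (h : ∀ᶠ x in 𝓝 p, φ x = Φ (chartAt E p x)) (hΦ : DifferentiableAt ℝ Φ (chartAt E p p))
    (v : E) : mvfderiv 𝓘(ℝ, E) φ p v = fderiv ℝ Φ (chartAt E p p) v := by
  have h1 : mfderiv 𝓘(ℝ, E) 𝓘(ℝ, ℝ) φ p = mfderiv 𝓘(ℝ, E) 𝓘(ℝ, ℝ) (Φ ∘ chartAt E p) p :=
    Filter.EventuallyEq.mfderiv_eq h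
  have h2 := mfderiv_comp (I := 𝓘(ℝ, E)) (I' := 𝓘(ℝ, E)) (I'' := 𝓘(ℝ, ℝ)) p (g := Φ)
    (f := chartAt E p) hΦ.mdifferentiableAt (chart_mdifferentiableAt (mem_chart_source E p))
  rw [mfderiv_eq_fderiv] at h2
  have h3 : mfderiv 𝓘(ℝ, E) 𝓘(ℝ, ℝ) φ p v = fderiv ℝ Φ (chartAt E p p) (chartD p p v) :=
    congrArg (fun A : E →L[ℝ] ℝ => A v) (h1.trans h2)
  rw [chartD_self] at h3
  exact h3

end CoordinateFields

/-! ### The metric and the fundamental form in a chart -/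

section MetricInChart

variable {E : Type*} [NormedAddCommGroup E] [NormedSpace ℂ E]
variable {M : Type*} [TopologicalSpace M] [ChartedSpace E M] [IsManifold 𝓘(ℂ, E) ω M]

/-- The expression of a metric in the preferred chart at `p`. -/
def metricInChart (g : Metric E M) (p : M) (y : E) : E →L[ℝ] E →L[ℝ] ℝ :=
  (g.bil ((chartAt E p).symm y)).bilinearComp (chartSymmD p y) (chartSymmD p y)

theorem metricInChart_apply (g : Metric E M) (p : M) (y u v : E) :
    metricInChart g p y u v =
      g.bil ((chartAt E p).symm y) (chartSymmD p y u) (chartSymmD p y v) := rfl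

theorem metricInChart_symm (g : Metric E M) (p : M) (y u v : E) :
    metricInChart g p y u v = metricInChart g p y v u :=
  g.symm ((chartAt E p).symm y) (chartSymmD p y u) (chartSymmD p y v)

theorem metricInChart_cplxJ {g : Metric E M} (hg : IsHermitian g) {p : M} {y : E}
    (hy : y ∈ (chartAt E p).target) (u v : E) :
    metricInChart g p y (cplxJ E u) (cplxJ E v) = metricInChart g p y u v := by
  simp only [metricInChart_apply, chartSymmD_cplxJ hy, hg _ _ _]

theorem inner_coordField (g : Metric E M) {p x : M} (hx : x ∈ (chartAt E p).source) (u v : E) :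
    g.inner x (coordField p u x) (coordField p v x) =
      metricInChart g p (chartAt E p x) u v := by
  rw [metricInChart_apply, (chartAt E p).left_inv hx, ← coordField_apply hx, ← coordField_apply hx]
  rfl

theorem inChart_fundamentalForm {g : Metric E M} (hg : IsHermitian g) {p : M} {y : E}
    (hy : y ∈ (chartAt E p).target) (u v : E) :
    inChart p (fundamentalForm g) y ![u, v] = metricInChart g p y (cplxJ E u) v := by
  have h1 : chartSymmD p y ∘ ![u, v] = ![chartSymmD p y u, chartSymmD p y v] := by
    funext i; fin_cases i <;> rfl
  rw [metricInChart_apply, chartSymmD_cplxJ hy, ← fundamentalForm_apply hg]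
  simp only [inChart, ContinuousAlternatingMap.compContinuousLinearMap_apply, h1]

variable [FiniteDimensional ℂ E]

theorem contDiffOn_metricInChart (g : Metric E M) (p : M) :
    ContDiffOn ℝ ∞ (metricInChart g p) (chartAt E p).target := by
  have : CompleteSpace E := FiniteDimensional.complete ℂ E
  -- In finite dimension smoothness can be tested on fixed `u` and `v`; the entries are inner
  -- products of smooth coordinate fields.
  refine contDiffOn_clm_apply.2 fun u => contDiffOn_clm_apply.2 fun v => ?_
  intro y hy
  refine ContDiffAt.contDiffWithinAt ?_
  have hx : (chartAt E p).symm y ∈ (chartAt E p).source := (chartAt E p).map_target hy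
  have h1 : ContMDiffAt 𝓘(ℝ, E) 𝓘(ℝ, ℝ) ∞
      (fun x => g.inner x (coordField p u x) (coordField p v x)) ((chartAt E p).symm y) := by
    have h2 := ContMDiffAt.clm_bundle_apply₂ (E₃ := Bundle.Trivial M ℝ) (F₃ := ℝ)
      (b := fun x : M => x) (g.contMDiff ((chartAt E p).symm y))
      (contMDiffAt_coordField hx u) (contMDiffAt_coordField hx v)
    simp only [contMDiffAt_totalSpace] at h2
    exact h2.2
  have h3 : ContMDiffAt 𝓘(ℝ, E) 𝓘(ℝ, E) ∞ (chartAt E p).symm y :=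
    (contMDiffOn_chart_symm (I := 𝓘(ℝ, E)) (n := ∞) (x := p)).contMDiffAt
      ((chartAt E p).open_target.mem_nhds hy)
  refine (h1.comp y h3).contDiffAt.congr_of_eventuallyEq ?_
  filter_upwards [(chartAt E p).open_target.mem_nhds hy] with z hz
  have hz' := inner_coordField g ((chartAt E p).map_target hz) u v
  rw [(chartAt E p).right_inv hz] at hz'
  exact hz'.symm

theorem differentiableAt_metricInChart (g : Metric E M) {p : M} {y : E}
    (hy : y ∈ (chartAt E p).target) : DifferentiableAt ℝ (metricInChart g p) y :=
  ((contDiffOn_metricInChart g p).contDiffAt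
    ((chartAt E p).open_target.mem_nhds hy)).differentiableAt (by simp)

theorem fderiv_metricInChart_apply (g : Metric E M) {p : M} {y : E}
    (hy : y ∈ (chartAt E p).target) (a u v : E) :
    fderiv ℝ (fun z => metricInChart g p z u v) y a = fderiv ℝ (metricInChart g p) y a u v := by
  have h := differentiableAt_metricInChart g hy
  have h1 := ((h.hasFDerivAt.clm_apply (hasFDerivAt_const u y)).clm_apply
    (hasFDerivAt_const v y)).fderiv
  rw [h1]
  simp

theorem differentiableAt_inChart_fundamentalForm {g : Metric E M} (hg : IsHermitian g) {p : M}
    {y : E} (hy : y ∈ (chartAt E p).target) :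
    DifferentiableAt ℝ (inChart p (fundamentalForm g)) y := by
  let A : (E →L[ℝ] ℝ) →L[ℝ] E [⋀^Fin 1]→L[ℝ] ℝ :=
    (ContinuousAlternatingMap.ofSubsingletonLIE (𝕜 := ℝ) (E := E) (F := ℝ)
        (0 : Fin 1)).toContinuousLinearEquiv.toContinuousLinearMap
  -- Near `y` the form is a fixed continuous linear image of the metric, so it inherits
  -- differentiability.
  have he : inChart p (fundamentalForm g) =ᶠ[𝓝 y] fun z => (1 / 2 : ℝ) •
      ContinuousAlternatingMap.alternatizeUncurryFinCLM ℝ E ℝ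
        (A.comp ((metricInChart g p z).comp (cplxJ E))) := by
    filter_upwards [(chartAt E p).open_target.mem_nhds hy] with z hz
    ext w
    have hw : w = ![w 0, w 1] := by funext i; fin_cases i <;> rfl
    have h2 : metricInChart g p z (cplxJ E (w 1)) (w 0) =
        -metricInChart g p z (cplxJ E (w 0)) (w 1) := by
      rw [metricInChart_symm, ← metricInChart_cplxJ hg hz (w 0), cplxJ_cplxJ]
      simp
    rw [hw, inChart_fundamentalForm hg hz]
    simp [A, ContinuousAlternatingMap.alternatizeUncurryFin_apply, Fin.sum_univ_two,
      Fin.removeNth, h2]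
    ring
  refine DifferentiableAt.congr_of_eventuallyEq ?_ he
  have := differentiableAt_metricInChart g hy
  fun_prop

theorem fderiv_inChart_fundamentalForm {g : Metric E M} (hg : IsHermitian g) {p : M} {y : E}
    (hy : y ∈ (chartAt E p).target) (a u v : E) :
    fderiv ℝ (inChart p (fundamentalForm g)) y a ![u, v] =
      fderiv ℝ (metricInChart g p) y a (cplxJ E u) v := by
  have hd := differentiableAt_inChart_fundamentalForm hg hy
  have h1 := (((ContinuousAlternatingMap.apply ℝ E ℝ ![u, v]).hasFDerivAt).comp y
    hd.hasFDerivAt).fderiv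
  have he : (ContinuousAlternatingMap.apply ℝ E ℝ ![u, v]) ∘ inChart p (fundamentalForm g)
      =ᶠ[𝓝 y] fun z => metricInChart g p z (cplxJ E u) v := by
    filter_upwards [(chartAt E p).open_target.mem_nhds hy] with z hz
    exact inChart_fundamentalForm hg hz u v
  rw [he.fderiv_eq] at h1
  rw [← fderiv_metricInChart_apply g hy, h1]
  rfl

theorem fderiv_metricInChart_symm (g : Metric E M) {p : M} {y : E}
    (hy : y ∈ (chartAt E p).target) (a u v : E) :
    fderiv ℝ (metricInChart g p) y a u v = fderiv ℝ (metricInChart g p) y a v u := by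
  rw [← fderiv_metricInChart_apply g hy, ← fderiv_metricInChart_apply g hy]
  simp only [metricInChart_symm g p _ u v]

theorem fderiv_metricInChart_cplxJ {g : Metric E M} (hg : IsHermitian g) {p : M} {y : E}
    (hy : y ∈ (chartAt E p).target) (a u v : E) :
    fderiv ℝ (metricInChart g p) y a (cplxJ E u) (cplxJ E v) =
      fderiv ℝ (metricInChart g p) y a u v := by
  rw [← fderiv_metricInChart_apply g hy, ← fderiv_metricInChart_apply g hy]
  refine congrArg (fun A : E →L[ℝ] ℝ => A a) (Filter.EventuallyEq.fderiv_eq ?_)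
  filter_upwards [(chartAt E p).open_target.mem_nhds hy] with z hz
  exact metricInChart_cplxJ hg hz u v

end MetricInChart

/-! ### Christoffel symbols, the structure equation and uniqueness -/

section Rigidity

variable {E : Type*} [NormedAddCommGroup E] [NormedSpace ℂ E] [FiniteDimensional ℂ E]
variable {M : Type*} [TopologicalSpace M] [ChartedSpace E M] [IsManifold 𝓘(ℂ, E) ω M]

theorem isDiffAt_coordField (p : M) (u : E) : IsDiffAt (coordField p u) p :=
  have : CompleteSpace E := FiniteDimensional.complete ℂ E
  (contMDiffAt_coordField (mem_chart_source E p) u).mdifferentiableAt (by simp)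

/-- The Christoffel symbols of the connection `D` at `p`, in the preferred chart at `p`:
the derivative of the coordinate field `u` in the direction `a`. -/
def christoffel (D : CovariantDerivative 𝓘(ℝ, E) E (fun x : M => TangentSpace 𝓘(ℝ, E) x))
    (p : M) (a u : E) : E := D (coordField p u) p a

theorem IsLeviCivita.christoffel_symm {g : Metric E M}
    {D : CovariantDerivative 𝓘(ℝ, E) E (fun x : M => TangentSpace 𝓘(ℝ, E) x)}
    (h : IsLeviCivita g D) (p : M) (a u : E) : christoffel D p a u = christoffel D p u a := by
  have : CompleteSpace E := FiniteDimensional.complete ℂ E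
  have h1 := CovariantDerivative.torsion_eq_zero_iff D |>.1 h.torsion_free
    (isDiffAt_coordField p a) (isDiffAt_coordField p u)
  rw [mlieBracket_coordField, coordField_self, coordField_self] at h1
  exact sub_eq_zero.1 h1

theorem IsLeviCivita.fderiv_metricInChart {g : Metric E M}
    {D : CovariantDerivative 𝓘(ℝ, E) E (fun x : M => TangentSpace 𝓘(ℝ, E) x)}
    (h : IsLeviCivita g D) (p : M) (a u v : E) :
    fderiv ℝ (metricInChart g p) (chartAt E p p) a u v =
      g.bil p (christoffel D p a u) v + g.bil p u (christoffel D p a v) := by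
  have hy := mem_chart_target E p
  have h1 := h.metric p (coordField p u) (coordField p v) (isDiffAt_coordField p u)
    (isDiffAt_coordField p v) a
  have h2 := mvfderiv_eq_of_eventuallyEq_comp_chart
    (φ := fun x => g.inner x (coordField p u x) (coordField p v x))
    (Φ := fun z => metricInChart g p z u v) (p := p)
    (Filter.eventually_of_mem ((chartAt E p).open_source.mem_nhds (mem_chart_source E p))
      fun x hx => inner_coordField g hx u v)
    (((differentiableAt_metricInChart g hy).clm_apply (differentiableAt_const u)).clm_apply
      (differentiableAt_const v)) a
  rw [← fderiv_metricInChart_apply g hy, ← h2]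
  refine h1.trans ?_
  rw [coordField_self, coordField_self]
  rfl

theorem IsParallel.fderiv_inChart
    {D : CovariantDerivative 𝓘(ℝ, E) E (fun x : M => TangentSpace 𝓘(ℝ, E) x)}
    {θ : DiffForm E M 1} (h : IsParallel D θ) (hθ : IsSmooth θ) (p : M) (a u : E) :
    fderiv ℝ (inChart p θ) (chartAt E p p) a ![u] = θ p ![christoffel D p a u] := by
  have hy := mem_chart_target E p
  have hd := (hθ.contDiffAt hy).differentiableAt (by simp)
  have hΦ := ((ContinuousAlternatingMap.apply ℝ E ℝ ![u]).hasFDerivAt).comp (chartAt E p p)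
    hd.hasFDerivAt
  have h1 := h p (coordField p u) (isDiffAt_coordField p u) a
  have h2 := mvfderiv_eq_of_eventuallyEq_comp_chart
    (φ := fun x => θ x ![coordField p u x])
    (Φ := (ContinuousAlternatingMap.apply ℝ E ℝ ![u]) ∘ inChart p θ) (p := p)
    (Filter.eventually_of_mem ((chartAt E p).open_source.mem_nhds (mem_chart_source E p))
      fun x hx => by
        have h3 : chartSymmD p (chartAt E p x) ∘ ![u] = ![chartSymmD p (chartAt E p x) u] := by
          funext i; fin_cases i; rfl
        simp only [Function.comp_apply, ContinuousAlternatingMap.apply_apply, inChart,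
          ContinuousAlternatingMap.compContinuousLinearMap_apply, h3]
        rw [(chartAt E p).left_inv hx]
        exact congrArg (fun w : E => θ x ![w]) (coordField_apply hx u))
    hΦ.differentiableAt a
  rw [hΦ.fderiv] at h2
  exact h2.symm.trans h1

/-- A parallel form `θ = g(T, ·)` is differentiated in a chart by Koszul's formula. -/
theorem two_mul_fderiv_inChart_lee (S : VaismanStructure E M) {p : M} {T : E}
    (hT : ∀ v, S.lee p ![v] = S.g.bil p T v) (a u : E) :
    2 * fderiv ℝ (inChart p S.lee) (chartAt E p p) a ![u] =
      fderiv ℝ (metricInChart S.g p) (chartAt E p p) a u T +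
      fderiv ℝ (metricInChart S.g p) (chartAt E p p) u a T -
      fderiv ℝ (metricInChart S.g p) (chartAt E p p) T a u := by
  obtain ⟨D, hD, hpar⟩ := S.parallel
  have hsymm : ∀ v w : E, S.g.bil p v w = S.g.bil p w v := fun v w => S.g.symm p v w
  rw [hpar.fderiv_inChart S.lee_mem.1, hT, hD.fderiv_metricInChart, hD.fderiv_metricInChart,
    hD.fderiv_metricInChart, hD.christoffel_symm p u a, hD.christoffel_symm p T a,
    hD.christoffel_symm p T u, hsymm T, hsymm u (christoffel D p a T)]
  ring

/-- The structure equation `d(θ ∘ I) = |θ|² Ω + θ ∧ (θ ∘ I)` of a Vaisman structure, at the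
centre of a chart. -/
theorem fderiv_inChart_lee_cplxJ (S : VaismanStructure E M) {p : M} {T : E}
    (hT : ∀ v, S.lee p ![v] = S.g.bil p T v) (u v : E) :
    fderiv ℝ (inChart p S.lee) (chartAt E p p) u ![cplxJ E v] -
        fderiv ℝ (inChart p S.lee) (chartAt E p p) v ![cplxJ E u] =
      S.g.bil p T T * S.g.bil p (cplxJ E u) v +
        S.lee p ![u] * S.lee p ![cplxJ E v] - S.lee p ![v] * S.lee p ![cplxJ E u] := by
  have hy := mem_chart_target E p
  have hg := S.hermitian
  have hlck : ∀ a b c : E,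
      fderiv ℝ (metricInChart S.g p) (chartAt E p p) a (cplxJ E b) c -
        fderiv ℝ (metricInChart S.g p) (chartAt E p p) b (cplxJ E a) c +
        fderiv ℝ (metricInChart S.g p) (chartAt E p p) c (cplxJ E a) b =
      S.lee p ![a] * S.g.bil p (cplxJ E b) c - S.lee p ![b] * S.g.bil p (cplxJ E a) c +
        S.lee p ![c] * S.g.bil p (cplxJ E a) b := by
    intro a b c
    have h := congrArg (fun Ω : DiffForm E M 3 => Ω p ![a, b, c]) S.lck
    simp only [extD_eq, extDeriv_two_form_apply, wedgeOne_apply, fundamentalForm_apply hg,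
      fderiv_inChart_fundamentalForm hg hy] at h
    exact h
  -- The equation `dΩ = θ ∧ Ω` is used at these two triples only; their sum contains exactly the
  -- metric derivatives occurring in `k1 - k2`.
  have h1 := hlck u v T
  have h2 := hlck (cplxJ E u) (cplxJ E v) T
  have k1 := two_mul_fderiv_inChart_lee S hT u (cplxJ E v)
  have k2 := two_mul_fderiv_inChart_lee S hT v (cplxJ E u)
  have hsymm : ∀ v w : E, S.g.bil p v w = S.g.bil p w v := fun v w => S.g.symm p v w
  have e1 := fderiv_metricInChart_cplxJ hg hy T v u
  have e2 := fderiv_metricInChart_cplxJ hg hy T u (cplxJ E v)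
  have e3 := fderiv_metricInChart_symm S.g hy T v (cplxJ E u)
  have e4 := fderiv_metricInChart_symm S.g hy T u (cplxJ E v)
  simp only [cplxJ_cplxJ, map_neg, neg_apply] at h1 h2 e2
  have hu : S.g.bil p u T = S.lee p ![u] := by rw [hT, hsymm]
  have hv : S.g.bil p v T = S.lee p ![v] := by rw [hT, hsymm]
  have hJu : S.g.bil p (cplxJ E u) T = S.lee p ![cplxJ E u] := by rw [hT, hsymm]
  have hJv : S.g.bil p (cplxJ E v) T = S.lee p ![cplxJ E v] := by rw [hT, hsymm]
  have huv : S.g.bil p u (cplxJ E v) = -S.g.bil p (cplxJ E u) v := by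
    have := hg p u (cplxJ E v)
    rw [cplxJ_cplxJ, map_neg] at this
    linarith
  rw [hu, hv, huv, hT T] at h2
  rw [hJu, hJv, hT T] at h1
  -- By the symmetry `e3`, `k1 - k2` matches `h1 + h2`; both sides are twice the claimed identity.
  linarith

/-- The metric of a normalized Vaisman structure is determined by its Lee form. -/
theorem VaismanStructure.eq_of_lee_eq {S S' : VaismanStructure E M} (hlee : S.lee = S'.lee)
    (h : S.IsNormalized) (h' : S'.IsNormalized) : S = S' := by
  have hJ : ∀ (p : M) (u v : E), S.g.bil p (cplxJ E u) v = S'.g.bil p (cplxJ E u) v := by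
    intro p u v
    obtain ⟨T, hT, hTT⟩ := h p
    obtain ⟨T', hT', hTT'⟩ := h' p
    have h1 := fderiv_inChart_lee_cplxJ S hT u v
    have h2 := fderiv_inChart_lee_cplxJ S' hT' u v
    rw [hTT] at h1
    rw [hTT', ← hlee] at h2
    linarith
  have hbil : ∀ (p : M) (u v : E), S.g.bil p u v = S'.g.bil p u v := by
    intro p u v
    -- Chosen because `I(-I u) = u`.
    have h1 := hJ p (-cplxJ E u) v
    rwa [map_neg, cplxJ_cplxJ, neg_neg] at h1
  have hinner : S.g.inner = S'.g.inner := by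
    funext p
    exact ContinuousLinearMap.ext fun u => ContinuousLinearMap.ext fun v => hbil p u v
  have hg : S.g = S'.g := by
    -- `inner` is the only data of a metric; its other fields are propositions.
    generalize S.g = g at hinner
    generalize S'.g = g' at hinner
    cases g
    cases g'
    simp only at hinner
    subst hinner
    rfl
  exact VaismanStructure.ext hg hlee

/-- The Lee form of a Vaisman structure on a compact manifold is determined by the transversal
form and the Lee class. -/
theorem VaismanStructure.lee_eq [CompactSpace M] {S S' : VaismanStructure E M}
    (hform : S.transversalForm = S'.transversalForm) (hclass : S.leeClass = S'.leeClass) :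
    S.lee = S'.lee := by
  have h := (Submodule.Quotient.eq _).1 hclass
  obtain ⟨f, hf, hα⟩ : S.lee - S'.lee ∈ exactOneForms E M := h
  exact sub_eq_zero.1 (eq_zero_of_exact_of_pluriharmonic hf hα fun p y hy u v =>
    fderiv_inChart_of_extDc_eq S.lee_mem.1 S'.lee_mem.1 hform hy u v)

end Rigidity

end Vaisman

end

theorem mainTheorem4 (n : ℕ) (hn : 2 ≤ n)
    (E : Type*) [NormedAddCommGroup E] [NormedSpace ℂ E] [FiniteDimensional ℂ E]
    (hE : Module.finrank ℂ E = n)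
    (M : Type*) [TopologicalSpace M] [T2Space M] [CompactSpace M]
    [ChartedSpace E M] [IsManifold 𝓘(ℂ, E) ω M]
    (S S' : Vaisman.VaismanStructure E M)
    (hform : S.transversalForm = S'.transversalForm)
    (hclass : S.leeClass = S'.leeClass) :
    S.lee = S'.lee ∧ (S.IsNormalized → S'.IsNormalized → S = S') := by
  have hlee := Vaisman.VaismanStructure.lee_eq hform hclass
  exact ⟨hlee, Vaisman.VaismanStructure.eq_of_lee_eq hlee⟩
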